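/- Let $k$ be a field and let $h\ge 2$ be an integer. Put $m_0=2h(2h-1)$, $m_1=(2h+1)(2h-1)$, $m_2=2h(2h+1)$, $m_3=2h(2h+1)+(2h-1)$, and let $\Gamma_h=\langle m_0,m_1,m_2,m_3\rangle\subseteq\mathbb{N}$ be the numerical semigroup of the Bresinsky curve. Let $R=k[[t^{m_0},t^{m_1},t^{m_2},t^{m_3}]]$, the local ring of all power series in $k[[t]]$ whose exponents lie in $\Gamma_h$, and let $\mathfrak m$ be its maximal ideal. Then the tangent cone $$G_{\mathfrak m}(\Gamma_h)=\bigoplus_{n\ge 0}\mathfrak m^n/\mathfrak m^{n+1}$$ of the Bresinsky curve at the origin is a Cohen–Macaulay ring, i.e. it is Noetherian and each of its localizations at a maximal ideal has depth equal to its Krull dimension. -/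

import Mathlib

open PowerSeries

noncomputable section

/-! ### Associated graded rings and tangent cones -/

/-- The associated graded ring `gr_I(R) = ⨁ₙ Iⁿ / Iⁿ⁺¹` of an ideal `I` of a commutative ring `R`,
as the quotient `R[It] / I R[It]` of the Rees algebra `R[It] = ⨁ₙ Iⁿ tⁿ`: the component of degree
`n` of the ideal `I R[It]` is `Iⁿ⁺¹ tⁿ`. -/
abbrev AssociatedGradedRing {R : Type*} [CommRing R] (I : Ideal R) : Type _ :=
  reesAlgebra I ⧸ I.map (algebraMap R (reesAlgebra I))

/-- The tangent cone `⨁ₙ 𝔪ⁿ / 𝔪ⁿ⁺¹` of a local ring with maximal ideal `𝔪`. -/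
abbrev TangentCone (R : Type*) [CommRing R] [IsLocalRing R] : Type _ :=
  AssociatedGradedRing (IsLocalRing.maximalIdeal R)

/-! ### Cohen–Macaulay rings -/

/-- The depth of a local ring: the supremum of the lengths of the regular sequences
in its maximal ideal. -/
def localDepth (R : Type*) [CommRing R] [IsLocalRing R] : ℕ∞ :=
  ⨆ rs : {rs : List R // (∀ r ∈ rs, r ∈ IsLocalRing.maximalIdeal R) ∧
    RingTheory.Sequence.IsRegular R rs}, (rs.1.length : ℕ∞)

/-- A Cohen–Macaulay local ring: a Noetherian local ring whose depth is its Krull dimension. -/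
structure IsCohenMacaulayLocalRing (R : Type*) [CommRing R] [IsLocalRing R] : Prop where
  isNoetherianRing : IsNoetherianRing R
  depth_eq_dim : (localDepth R : WithBot ℕ∞) = ringKrullDim R

/-- A Cohen–Macaulay ring: a Noetherian ring whose localizations at all maximal ideals are
Cohen–Macaulay local rings. -/
structure IsCohenMacaulayRing (R : Type*) [CommRing R] : Prop where
  isNoetherianRing : IsNoetherianRing R
  localization : ∀ (p : Ideal R) [p.IsMaximal],
    IsCohenMacaulayLocalRing (Localization.AtPrime p)

/-! ### Semigroup rings -/

/-- The ring `k⟦Γ⟧ ⊆ k⟦t⟧` of the power series whose exponents lie in `Γ`. For `Γ` generated by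
`a₁, …, aₑ` this is `k⟦t^a₁, …, t^aₑ⟧`. -/
def semigroupPowerSeries (k : Type*) [Field k] (Γ : AddSubmonoid ℕ) : Subalgebra k k⟦X⟧ where
  carrier := {f | ∀ n, coeff n f ≠ 0 → n ∈ Γ}
  mul_mem' := by
    intro f g hf hg n hn
    rw [coeff_mul] at hn
    obtain ⟨x, hx, hne⟩ := Finset.exists_ne_zero_of_sum_ne_zero hn
    rw [← Finset.HasAntidiagonal.mem_antidiagonal.mp hx]
    exact Γ.add_mem (hf _ (left_ne_zero_of_mul hne)) (hg _ (right_ne_zero_of_mul hne))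
  add_mem' := by
    intro f g hf hg n hn
    by_cases h : coeff n f = 0
    · exact hg n fun h' => hn (by rw [map_add, h, h', add_zero])
    · exact hf n h
  algebraMap_mem' := by
    intro r n hn
    rw [PowerSeries.algebraMap_apply, Algebra.algebraMap_self, RingHom.id_apply, coeff_C] at hn
    split_ifs at hn with h
    · exact h ▸ Γ.zero_mem
    · exact absurd rfl hn

theorem inv_mem_semigroupPowerSeries {k : Type*} [Field k] {Γ : AddSubmonoid ℕ} {f : k⟦X⟧}
    (hf : f ∈ semigroupPowerSeries k Γ) : f⁻¹ ∈ semigroupPowerSeries k Γ := by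
  intro n
  induction n using Nat.strong_induction_on with
  | _ n ih =>
    intro hn
    rw [coeff_inv] at hn
    split_ifs at hn with h
    · exact h ▸ Γ.zero_mem
    · obtain ⟨x, hx, hne⟩ := Finset.exists_ne_zero_of_sum_ne_zero (right_ne_zero_of_mul hn)
      split_ifs at hne with hlt
      · rw [← Finset.HasAntidiagonal.mem_antidiagonal.mp hx]
        exact Γ.add_mem (hf _ (left_ne_zero_of_mul hne)) (ih _ hlt (right_ne_zero_of_mul hne))
      · exact absurd rfl hne

theorem isUnit_semigroupPowerSeries_iff {k : Type*} [Field k] {Γ : AddSubmonoid ℕ}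
    (f : semigroupPowerSeries k Γ) : IsUnit f ↔ constantCoeff (f : k⟦X⟧) ≠ 0 := by
  constructor
  · intro h
    exact ((h.map (semigroupPowerSeries k Γ).val).map (constantCoeff (R := k))).ne_zero
  · intro h
    exact IsUnit.of_mul_eq_one ⟨_, inv_mem_semigroupPowerSeries f.2⟩
      (Subtype.ext (PowerSeries.mul_inv_cancel _ h))

instance isLocalRing_semigroupPowerSeries (k : Type*) [Field k] (Γ : AddSubmonoid ℕ) :
    IsLocalRing (semigroupPowerSeries k Γ) :=
  IsLocalRing.of_nonunits_add fun f g hf hg => by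
    rw [mem_nonunits_iff, isUnit_semigroupPowerSeries_iff, not_not] at hf hg ⊢
    rw [Subalgebra.coe_add, map_add, hf, hg, add_zero]

/-! ### The Bresinsky curves -/

/-- The numerical semigroup `Γ_h = ⟨m₀, m₁, m₂, m₃⟩` of the Bresinsky curve, with `m₀ = 2h(2h-1)`,
`m₁ = (2h+1)(2h-1)`, `m₂ = 2h(2h+1)`, `m₃ = 2h(2h+1)+(2h-1)`; to be used for `h ≥ 2`. -/
def bresinskySemigroup (h : ℕ) : AddSubmonoid ℕ :=
  AddSubmonoid.closure {2 * h * (2 * h - 1), (2 * h + 1) * (2 * h - 1), 2 * h * (2 * h + 1),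
    2 * h * (2 * h + 1) + (2 * h - 1)}

end

noncomputable section

/-! ### A criterion for Cohen–Macaulayness in dimension one -/

/-! Let `x` be the initial form of `t^m₀`, where `m₀` is the least generator. Since `(t^mᵢ)^m₀ =
(t^m₀)^mᵢ` and `mᵢ > m₀`, the other initial forms are nilpotent. Modulo nilpotents the tangent cone
is thus a quotient of `k[x]`, so it has dimension at most one and every maximal ideal contains some
`f(x)` with `f ≠ 0`. It remains to see that the tangent cone is torsion-free over `k[x]`; taking the
lowest term of `f` reduces this to regularity of `x`. By `mem_maximalIdeal_pow_iff` regularity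
becomes a statement on exponents: if `m₀ + s` is a sum of `n + 1` or more generators, then `s` is a
sum of `n` or more.

Put `q = 2h`. The relations `m₁ + m₂ = m₀ + m₃`, `q m₁ = (q+1) m₀` and `(q-1) m₂ = (q+1) m₀` bring
any factorization to the form `B + D < q`, `C + D < q - 1` (`exists_normal_factorization`), and such
a factorization is a longest one (`length_le_of_normal_factorization`). The bounds do not involve
the coefficient of `m₀`, so adding `m₀` raises the maximal length by exactly one. -/

theorem mem_of_isNilpotent {A : Type*} [CommRing A] (p : Ideal A) [p.IsPrime] {a : A}
    (ha : IsNilpotent a) : a ∈ p := by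
  obtain ⟨n, hn⟩ := ha
  exact Ideal.IsPrime.mem_of_pow_mem (I := p) inferInstance n (hn ▸ p.zero_mem)

section Criterion

variable {k G : Type*} [Field k] [CommRing G] [Algebra k G] {x : G}

/-- A prime contains all nilpotents, so it is determined by its preimage in `k[X]`. Hence chains of
primes of `G` map to chains of primes of `k[X]` without collapsing. -/
theorem ringKrullDim_le_one_of_aeval
    (hsurj : ∀ y : G, ∃ f : Polynomial k, IsNilpotent (y - Polynomial.aeval x f)) :
    ringKrullDim G ≤ 1 := by
  have hmono : StrictMono (PrimeSpectrum.comap (Polynomial.aeval (R := k) x).toRingHom) := by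
    intro p q hpq
    refine lt_of_le_not_ge (fun a ha => hpq.le ha) fun hqp => hpq.not_ge fun y hy => ?_
    obtain ⟨f, hf⟩ := hsurj y
    have hfq : Polynomial.aeval x f ∈ q.asIdeal := by
      have := q.asIdeal.sub_mem hy (mem_of_isNilpotent q.asIdeal hf)
      rwa [sub_sub_cancel] at this
    have hfp : Polynomial.aeval x f ∈ p.asIdeal := hqp (show f ∈ _ from hfq)
    have := p.asIdeal.add_mem (mem_of_isNilpotent p.asIdeal hf) hfp
    rwa [sub_add_cancel] at this
  calc ringKrullDim G ≤ ringKrullDim (Polynomial k) := Order.krullDim_le_of_strictMono _ hmono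
    _ = 1 := IsPrincipalIdealRing.ringKrullDim_eq_one _ (Polynomial.not_isField k)

/-- Otherwise `k[X] → G ⧸ p` would be bijective and `k[X]` would be a field. -/
theorem exists_ne_zero_aeval_mem
    (hsurj : ∀ y : G, ∃ f : Polynomial k, IsNilpotent (y - Polynomial.aeval x f))
    (p : Ideal G) [p.IsMaximal] : ∃ f : Polynomial k, f ≠ 0 ∧ Polynomial.aeval x f ∈ p := by
  have hs : Function.Surjective
      ((Ideal.Quotient.mk p).comp (Polynomial.aeval (R := k) x).toRingHom) := by
    intro y
    obtain ⟨y, rfl⟩ := Ideal.Quotient.mk_surjective y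
    obtain ⟨f, hf⟩ := hsurj y
    refine ⟨f, ((Ideal.Quotient.mk_eq_mk_iff_sub_mem _ _).2 (mem_of_isNilpotent p hf)).symm⟩
  by_contra! hcon
  have hinj : Function.Injective
      ((Ideal.Quotient.mk p).comp (Polynomial.aeval (R := k) x).toRingHom) := by
    rw [injective_iff_map_eq_zero]
    intro f hf
    by_contra h0
    exact hcon f h0 (Ideal.Quotient.eq_zero_iff_mem.1 hf)
  have hfield : IsField (G ⧸ p) := (Ideal.Quotient.maximal_ideal_iff_isField_quotient p).1 ‹_›
  exact Polynomial.not_isField k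
    ((RingEquiv.ofBijective _ ⟨hinj, hs⟩).toMulEquiv.isField hfield)

/-- A Noetherian local ring of dimension at most one with a regular element in its maximal ideal is
Cohen–Macaulay. -/
theorem isCohenMacaulayLocalRing_of_ringKrullDim_le_one {A : Type*} [CommRing A] [IsLocalRing A]
    [IsNoetherianRing A] (hdim : ringKrullDim A ≤ 1) {a : A}
    (ha : a ∈ IsLocalRing.maximalIdeal A) (hreg : a ∈ nonZeroDivisors A) :
    IsCohenMacaulayLocalRing A := by
  have hle : ∀ rs : List A, RingTheory.Sequence.IsRegular A rs →
      (rs.length : WithBot ℕ∞) ≤ ringKrullDim A := by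
    intro rs hrs
    rw [← ringKrullDim_add_length_eq_ringKrullDim_of_isRegular rs hrs]
    have : Nontrivial (A ⧸ Ideal.ofList rs) := by
      refine Ideal.Quotient.nontrivial_iff.2 fun htop => hrs.top_ne_smul ?_
      rw [htop, Submodule.top_smul]
    simpa using add_le_add_left (ringKrullDim_nonneg_of_nontrivial (R := A ⧸ Ideal.ofList rs))
      (rs.length : WithBot ℕ∞)
  have hsm : IsSMulRegular A a :=
    (isSMulRegular_iff_right_eq_zero_of_smul).2 fun b hb =>
      (mem_nonZeroDivisors_iff.1 hreg).1 b hb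
  have hseq : RingTheory.Sequence.IsRegular A [a] :=
    RingTheory.Sequence.IsRegular.of_isWeaklyRegular_of_mem_maximalIdeal
      A (by simpa using ha) (by simpa using hsm)
  have h1 : (1 : ℕ∞) ≤ localDepth A :=
    le_iSup_of_le (f := fun rs : {rs : List A // (∀ r ∈ rs, r ∈ IsLocalRing.maximalIdeal A) ∧
      RingTheory.Sequence.IsRegular A rs} => (rs.1.length : ℕ∞))
      ⟨[a], by simpa using ha, hseq⟩ (by simp)
  have hdim1 : ringKrullDim A = 1 := le_antisymm hdim (by simpa using hle [a] hseq)
  refine ⟨inferInstance, ?_⟩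
  rw [hdim1]
  refine congrArg WithBot.some (le_antisymm (iSup_le fun rs => ?_) h1)
  have := hle rs.1 rs.2.2
  rw [hdim1] at this
  exact_mod_cast this

/-- A Noetherian algebra over `k` that is torsion-free over `k[x]`, and that modulo nilpotents is
generated by `x`, is Cohen–Macaulay. -/
theorem isCohenMacaulayRing_of_aeval [IsNoetherianRing G]
    (hreg : ∀ f : Polynomial k, f ≠ 0 → Polynomial.aeval x f ∈ nonZeroDivisors G)
    (hsurj : ∀ y : G, ∃ f : Polynomial k, IsNilpotent (y - Polynomial.aeval x f)) :
    IsCohenMacaulayRing G := by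
  refine ⟨inferInstance, fun p _ => ?_⟩
  -- A maximal ideal need not contain `x` itself, hence the torsion-freeness over all of `k[x]`.
  obtain ⟨f, hf0, hfp⟩ := exists_ne_zero_aeval_mem hsurj p
  have : IsNoetherianRing (Localization.AtPrime p) :=
    IsLocalization.isNoetherianRing p.primeCompl _ inferInstance
  refine isCohenMacaulayLocalRing_of_ringKrullDim_le_one
    (a := algebraMap G (Localization.AtPrime p) (Polynomial.aeval x f)) ?_ ?_ ?_
  · rw [IsLocalization.AtPrime.ringKrullDim_eq_height p]
    exact (Ideal.height_le_ringKrullDim_of_ne_top (Ideal.IsPrime.ne_top inferInstance)).trans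
      (ringKrullDim_le_one_of_aeval hsurj)
  · exact (IsLocalization.AtPrime.to_map_mem_maximal_iff _ p _).2 hfp
  · exact IsLocalization.map_nonZeroDivisors_le p.primeCompl _
      (Submonoid.mem_map_of_mem _ (hreg f hf0))

theorem exists_isNilpotent_sub_aeval {s : Set G} (htop : Algebra.adjoin k s = ⊤)
    (hs : ∀ y ∈ s, y = x ∨ IsNilpotent y) (y : G) :
    ∃ f : Polynomial k, IsNilpotent (y - Polynomial.aeval x f) := by
  have hy : y ∈ Algebra.adjoin k s := htop ▸ Algebra.mem_top
  induction hy using Algebra.adjoin_induction with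
  | mem y hy =>
    rcases hs y hy with rfl | hy
    · exact ⟨Polynomial.X, by simp⟩
    · exact ⟨0, by simpa using hy⟩
  | algebraMap c => exact ⟨Polynomial.C c, by simp⟩
  | add a b _ _ ha hb =>
    obtain ⟨p, hp⟩ := ha
    obtain ⟨q, hq⟩ := hb
    refine ⟨p + q, ?_⟩
    rw [map_add, add_sub_add_comm]
    exact (Commute.all _ _).isNilpotent_add hp hq
  | mul a b _ _ ha hb =>
    obtain ⟨p, hp⟩ := ha
    obtain ⟨q, hq⟩ := hb
    refine ⟨p * q, ?_⟩
    rw [← mem_nilradical] at hp hq ⊢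
    have h := add_mem (Ideal.mul_mem_right b _ hp)
      (Ideal.mul_mem_left _ (Polynomial.aeval x p) hq)
    convert h using 1
    rw [map_mul]
    ring

/-- An algebra over a field generated by finitely many nilpotent elements and one element `x`, and
torsion-free over `k[x]`, is Cohen–Macaulay. -/
theorem isCohenMacaulayRing_of_adjoin_eq_top {s : Set G} (hfin : s.Finite)
    (htop : Algebra.adjoin k s = ⊤) (hs : ∀ y ∈ s, y = x ∨ IsNilpotent y)
    (hreg : ∀ f : Polynomial k, f ≠ 0 → ∀ y, y * Polynomial.aeval x f = 0 → y = 0) :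
    IsCohenMacaulayRing G := by
  have hft : Algebra.FiniteType k G := ⟨Subalgebra.fg_def.2 ⟨s, hfin, htop⟩⟩
  have : IsNoetherianRing G := Algebra.FiniteType.isNoetherianRing k G
  exact isCohenMacaulayRing_of_aeval (fun f hf => mem_nonZeroDivisors_iff_right.2 (hreg f hf))
    (exists_isNilpotent_sub_aeval htop hs)

end Criterion

/-! ### Associated graded rings -/

section AssociatedGradedRing

variable {R : Type*} [CommRing R] {I : Ideal R}

theorem coeff_mem_of_mem_map_algebraMap_reesAlgebra {z : reesAlgebra I}
    (hz : z ∈ I.map (algebraMap R (reesAlgebra I))) (n : ℕ) :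
    (z : Polynomial R).coeff n ∈ I ^ (n + 1) := by
  induction hz using Submodule.span_induction generalizing n with
  | mem z hz =>
    obtain ⟨r, hr, rfl⟩ := hz
    change (Polynomial.C r).coeff n ∈ _
    rw [Polynomial.coeff_C]
    split_ifs with h
    · simpa [h] using hr
    · exact zero_mem _
  | zero => simp
  | add z w _ _ hz hw => simpa using add_mem (hz n) (hw n)
  | smul w z _ hz =>
    rw [smul_eq_mul, Subalgebra.coe_mul, Polynomial.coeff_mul]
    refine Ideal.sum_mem _ fun ij hij => ?_
    rw [← Finset.HasAntidiagonal.mem_antidiagonal.1 hij, add_assoc, pow_add]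
    exact Ideal.mul_mem_mul (w.2 _) (hz _)

theorem monomial_mem_map_algebraMap_reesAlgebra {n : ℕ} {r : R} (hr : r ∈ I ^ (n + 1))
    (hr' : Polynomial.monomial n r ∈ reesAlgebra I) :
    (⟨Polynomial.monomial n r, hr'⟩ : reesAlgebra I) ∈ I.map (algebraMap R (reesAlgebra I)) := by
  -- The membership proof is quantified so that it can vary along the induction over `I * I ^ n`.
  have key : ∃ h, (⟨Polynomial.monomial n r, h⟩ : reesAlgebra I) ∈
      I.map (algebraMap R (reesAlgebra I)) := by
    rw [pow_succ'] at hr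
    refine Submodule.smul_induction_on hr (fun a ha b hb => ?_) fun a b ⟨ha, ha'⟩ ⟨hb, hb'⟩ => ?_
    · have hb' : Polynomial.monomial n b ∈ reesAlgebra I := reesAlgebra.monomial_mem.2 hb
      refine ⟨reesAlgebra.monomial_mem.2 (Ideal.mul_mem_left _ a hb), ?_⟩
      convert Ideal.mul_mem_right ⟨_, hb'⟩ _ (Ideal.mem_map_of_mem (algebraMap R (reesAlgebra I)) ha)
      change _ = Polynomial.C a * Polynomial.monomial n b
      rw [Polynomial.C_mul_monomial, smul_eq_mul]
    · refine ⟨by rw [map_add]; exact add_mem ha hb, ?_⟩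
      convert add_mem ha' hb' using 1
      exact Subtype.ext (map_add _ _ _)
  exact key.2

theorem mem_map_algebraMap_reesAlgebra_iff {z : reesAlgebra I} :
    z ∈ I.map (algebraMap R (reesAlgebra I)) ↔
      ∀ n, (z : Polynomial R).coeff n ∈ I ^ (n + 1) := by
  refine ⟨coeff_mem_of_mem_map_algebraMap_reesAlgebra, fun hz => ?_⟩
  have hmem : ∀ n, Polynomial.monomial n ((z : Polynomial R).coeff n) ∈ reesAlgebra I :=
    fun n => reesAlgebra.monomial_mem.2 (z.2 n)
  have hsum : z = ∑ n ∈ (z : Polynomial R).support, ⟨_, hmem n⟩ := by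
    refine Subtype.ext ?_
    rw [AddSubmonoidClass.coe_finsetSum]
    exact Polynomial.as_sum_support _
  rw [hsum]
  exact Ideal.sum_mem _ fun n _ => monomial_mem_map_algebraMap_reesAlgebra (hz n) _

/-- The initial form of degree one of an element of `I`, as an element of the Rees algebra. -/
def reesAlgebraOfMem (r : R) (hr : r ∈ I) : reesAlgebra I :=
  ⟨Polynomial.monomial 1 r, reesAlgebra.monomial_mem.2 (by rwa [pow_one])⟩

variable {k : Type*} [Field k] [Algebra k R]

theorem coeff_aeval_reesAlgebraOfMem {r : R} (hr : r ∈ I) (f : Polynomial k) (n : ℕ) :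
    (Polynomial.aeval (reesAlgebraOfMem r hr) f : Polynomial R).coeff n =
      algebraMap k R (f.coeff n) * r ^ n := by
  have hval : (Polynomial.aeval (reesAlgebraOfMem r hr) f : Polynomial R) =
      Polynomial.aeval (Polynomial.monomial 1 r) f :=
    (Polynomial.aeval_algHom_apply ((reesAlgebra I).val.restrictScalars k) _ f).symm
  rw [hval]
  clear hval
  induction f using Polynomial.induction_on' with
  | add p q hp hq => simp [hp, hq, add_mul]
  | monomial m a =>
    rw [Polynomial.aeval_monomial, Polynomial.monomial_pow, IsScalarTower.algebraMap_apply k R,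
      Polynomial.algebraMap_eq, Polynomial.C_mul_monomial, one_mul, Polynomial.coeff_monomial,
      Polynomial.coeff_monomial]
    split_ifs with h
    · rw [h]
    · simp

/-- If `j` is the lowest degree occurring in `f`, then once the components of `y` below degree `n`
vanish in `gr_I(R)`, the degree `n + j` component of the product is a nonzero scalar times `r ^ j *
yₙ`, and powers of `r` cancel. -/
theorem mem_map_of_aeval_reesAlgebraOfMem_mul_mem {r : R} (hr : r ∈ I)
    (hreg : ∀ n a, r * a ∈ I ^ (n + 1) → a ∈ I ^ n) {f : Polynomial k} (hf : f ≠ 0)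
    {y : reesAlgebra I}
    (hy : y * Polynomial.aeval (reesAlgebraOfMem r hr) f ∈
      I.map (algebraMap R (reesAlgebra I))) :
    y ∈ I.map (algebraMap R (reesAlgebra I)) := by
  have hpow : ∀ j n a, r ^ j * a ∈ I ^ (j + n) → a ∈ I ^ n := by
    intro j
    induction j with
    | zero => intro n a ha; simpa using ha
    | succ j ih =>
      intro n a ha
      refine ih n a (hreg _ _ ?_)
      rwa [← mul_assoc, ← pow_succ', add_right_comm]
  rw [mem_map_algebraMap_reesAlgebra_iff] at hy ⊢
  intro n
  induction n using Nat.strong_induction_on with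
  | _ n ih =>
  set j := f.natTrailingDegree with hj
  have hfj : f.coeff j ≠ 0 := by
    rw [hj, ← Polynomial.trailingCoeff]
    exact Polynomial.trailingCoeff_nonzero_iff_nonzero.2 hf
  have hsum := hy (n + j)
  rw [Subalgebra.coe_mul, Polynomial.coeff_mul, ← Finset.add_sum_erase _ _
    (Finset.HasAntidiagonal.mem_antidiagonal.2 (rfl : (n, j).1 + (n, j).2 = n + j))] at hsum
  have hrest : ∑ ab ∈ (Finset.HasAntidiagonal.antidiagonal (n + j)).erase (n, j),
      (y : Polynomial R).coeff ab.1 *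
        (Polynomial.aeval (reesAlgebraOfMem r hr) f : Polynomial R).coeff ab.2 ∈
      I ^ (n + j + 1) := by
    refine Ideal.sum_mem _ fun ab hab => ?_
    obtain ⟨a, b⟩ := ab
    rw [Finset.mem_erase, Finset.HasAntidiagonal.mem_antidiagonal] at hab
    obtain ⟨hne, heq⟩ := hab
    simp only at heq
    rw [coeff_aeval_reesAlgebraOfMem]
    -- Terms with `b < j` vanish by the choice of `j`; the others have `a < n` and fall under the
    -- induction hypothesis.
    rcases lt_or_ge b j with hb | hb
    · rw [Polynomial.coeff_eq_zero_of_lt_natTrailingDegree hb]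
      simp
    · have ha : a < n := by
        rcases eq_or_ne a n with rfl | h
        · exact absurd (by rw [show b = j by omega]) hne
        · omega
      rw [show n + j + 1 = (a + 1) + b by omega, pow_add]
      exact Ideal.mul_mem_mul (ih a ha) (Ideal.mul_mem_left _ _ (Ideal.pow_mem_pow hr b))
  have hmain := (Ideal.add_mem_iff_left _ hrest).1 hsum
  rw [coeff_aeval_reesAlgebraOfMem] at hmain
  refine hpow j _ _ ?_
  have := Ideal.mul_mem_left _ (algebraMap k R (f.coeff j)⁻¹) hmain
  have hone : algebraMap k R (f.coeff j)⁻¹ * algebraMap k R (f.coeff j) = 1 := by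
    rw [← map_mul, inv_mul_cancel₀ hfj, map_one]
  rw [show j + (n + 1) = n + j + 1 by omega]
  convert this using 1
  linear_combination (-(r ^ j * (y : Polynomial R).coeff n)) * hone

/-- The initial form of degree one of an element of `I`, as an element of `gr_I(R)`. -/
def associatedGradedRingOfMem (r : R) (hr : r ∈ I) : AssociatedGradedRing I :=
  Ideal.Quotient.mk (I.map (algebraMap R (reesAlgebra I))) (reesAlgebraOfMem r hr)

theorem eq_zero_of_mul_aeval_associatedGradedRingOfMem_eq_zero {r : R} (hr : r ∈ I)
    (hreg : ∀ n a, r * a ∈ I ^ (n + 1) → a ∈ I ^ n) {f : Polynomial k} (hf : f ≠ 0)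
    {y : AssociatedGradedRing I}
    (hy : y * Polynomial.aeval (associatedGradedRingOfMem r hr) f = 0) : y = 0 := by
  obtain ⟨y, rfl⟩ := Ideal.Quotient.mk_surjective y
  have hmap : Polynomial.aeval (associatedGradedRingOfMem r hr) f =
      Ideal.Quotient.mk (I.map (algebraMap R (reesAlgebra I)))
        (Polynomial.aeval (reesAlgebraOfMem r hr) f) :=
    Polynomial.aeval_algHom_apply
      (Ideal.Quotient.mkₐ k (I.map (algebraMap R (reesAlgebra I)))) _ f
  rw [hmap, ← map_mul, Ideal.Quotient.eq_zero_iff_mem] at hy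
  exact Ideal.Quotient.eq_zero_iff_mem.2
    (mem_map_of_aeval_reesAlgebraOfMem_mul_mem hr hreg hf hy)

variable {ι : Type*}

/-- The Rees algebra is generated over `R` in degree one, and modulo `I` the coefficients from `R`
reduce to scalars from `k`. -/
theorem adjoin_range_associatedGradedRing_eq_top {g : ι → R}
    (hspan : I = Ideal.span (Set.range g)) (hg : ∀ i, g i ∈ I)
    (hres : ∀ r : R, ∃ c : k, r - algebraMap k R c ∈ I) :
    Algebra.adjoin k (Set.range fun i => associatedGradedRingOfMem (g i) (hg i)) =
      (⊤ : Subalgebra k (AssociatedGradedRing I)) := by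
  set T : Subalgebra k (AssociatedGradedRing I) :=
    Algebra.adjoin k (Set.range fun i => associatedGradedRingOfMem (g i) (hg i))
  -- The polynomials in the Rees algebra whose class lies in `T`.
  let U : Subalgebra k (Polynomial R) :=
    (T.comap (Ideal.Quotient.mkₐ k (I.map (algebraMap R (reesAlgebra I))))).map
      ((reesAlgebra I).val.restrictScalars k)
  have hC : ∀ r : R, algebraMap R (Polynomial R) r ∈ U := by
    intro r
    refine ⟨algebraMap R (reesAlgebra I) r, ?_, rfl⟩
    change Ideal.Quotient.mk _ (algebraMap R (reesAlgebra I) r) ∈ T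
    obtain ⟨c, hc⟩ := hres r
    have : Ideal.Quotient.mk (I.map (algebraMap R (reesAlgebra I)))
        (algebraMap R (reesAlgebra I) r) = algebraMap k (AssociatedGradedRing I) c := by
      change _ = Ideal.Quotient.mk _ (algebraMap k (reesAlgebra I) c)
      rw [Ideal.Quotient.mk_eq_mk_iff_sub_mem, IsScalarTower.algebraMap_apply k R (reesAlgebra I),
        ← map_sub]
      exact Ideal.mem_map_of_mem _ hc
    rw [this]
    exact T.algebraMap_mem c
  have hX : ∀ i, Polynomial.monomial 1 (g i) ∈ U := fun i =>
    ⟨reesAlgebraOfMem (g i) (hg i), Algebra.subset_adjoin ⟨i, rfl⟩, rfl⟩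
  have hXI : ∀ r ∈ I, Polynomial.monomial 1 r ∈ U := by
    intro r hr
    rw [hspan] at hr
    induction hr using Submodule.span_induction with
    | mem r hr => obtain ⟨i, rfl⟩ := hr; exact hX i
    | zero => simp
    | add a b _ _ ha hb => rw [map_add]; exact add_mem ha hb
    | smul a b _ hb =>
      rw [← Polynomial.smul_monomial, Polynomial.smul_eq_C_mul]
      exact mul_mem (hC a) hb
  have hle : ∀ z ∈ reesAlgebra I, z ∈ U := by
    intro z hz
    rw [← adjoin_monomial_eq_reesAlgebra] at hz
    induction hz using Algebra.adjoin_induction with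
    | mem z hz => obtain ⟨r, hr, rfl⟩ := hz; exact hXI r hr
    | algebraMap r => exact hC r
    | add a b _ _ ha hb => exact add_mem ha hb
    | mul a b _ _ ha hb => exact mul_mem ha hb
  rw [eq_top_iff]
  rintro y -
  obtain ⟨y, rfl⟩ := Ideal.Quotient.mk_surjective y
  obtain ⟨z, hz, hzy⟩ := hle y y.2
  rwa [← Subtype.ext hzy]

theorem isNilpotent_associatedGradedRingOfMem {r : R} (hr : r ∈ I) {N : ℕ}
    (hN : r ^ N ∈ I ^ (N + 1)) :
    IsNilpotent (associatedGradedRingOfMem r hr) := by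
  refine ⟨N, ?_⟩
  change Ideal.Quotient.mk _ (reesAlgebraOfMem r hr) ^ N = 0
  rw [← map_pow, Ideal.Quotient.eq_zero_iff_mem, mem_map_algebraMap_reesAlgebra_iff]
  intro n
  change ((Polynomial.monomial 1 r) ^ N : Polynomial R).coeff n ∈ _
  rw [Polynomial.monomial_pow, one_mul, Polynomial.coeff_monomial]
  split_ifs with h
  · rwa [← h]
  · exact zero_mem _

/-- If `I` is generated by finitely many elements `g i`, one of which, `g i₀`, has an initial form
that is regular on `gr_I(R)` while all the others have nilpotent initial forms, then `gr_I(R)` is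
Cohen–Macaulay. -/
theorem isCohenMacaulayRing_associatedGradedRing [Finite ι] {g : ι → R}
    (hspan : I = Ideal.span (Set.range g)) (hres : ∀ r : R, ∃ c : k, r - algebraMap k R c ∈ I)
    (i₀ : ι) (hreg : ∀ n a, g i₀ * a ∈ I ^ (n + 1) → a ∈ I ^ n)
    (hnil : ∀ i, i ≠ i₀ → ∃ N, g i ^ N ∈ I ^ (N + 1)) :
    IsCohenMacaulayRing (AssociatedGradedRing I) := by
  have hg : ∀ i, g i ∈ I := fun i => hspan ▸ Ideal.subset_span ⟨i, rfl⟩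
  refine isCohenMacaulayRing_of_adjoin_eq_top (k := k)
    (x := associatedGradedRingOfMem (g i₀) (hg i₀)) (Set.finite_range _)
    (adjoin_range_associatedGradedRing_eq_top hspan hg hres) ?_
    fun f hf y hy => eq_zero_of_mul_aeval_associatedGradedRingOfMem_eq_zero (hg i₀) hreg hf hy
  rintro _ ⟨i, rfl⟩
  rcases eq_or_ne i i₀ with rfl | hi
  · exact Or.inl rfl
  · obtain ⟨N, hN⟩ := hnil i hi
    exact Or.inr (isNilpotent_associatedGradedRingOfMem (hg i) hN)

end AssociatedGradedRing

/-! ### Powers of the maximal ideal of a semigroup ring -/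

section SumsOfLength

variable {ι : Type*}

/-- The elements of the submonoid generated by the `g i` that are sums of at least `n` of the
`g i`. -/
def sumsOfLength (g : ι → ℕ) : ℕ → Set ℕ
  | 0 => AddSubmonoid.closure (Set.range g)
  | n + 1 => {s | ∃ i, ∃ u ∈ sumsOfLength g n, s = g i + u}

variable {g : ι → ℕ}

theorem sumsOfLength_succ_subset (n : ℕ) : sumsOfLength g (n + 1) ⊆ sumsOfLength g n := by
  induction n with
  | zero =>
    rintro _ ⟨i, u, hu, rfl⟩
    exact AddSubmonoid.add_mem _ (AddSubmonoid.subset_closure ⟨i, rfl⟩) hu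
  | succ n ih =>
    rintro _ ⟨i, u, hu, rfl⟩
    exact ⟨i, u, ih hu, rfl⟩

theorem sumsOfLength_subset_closure (n : ℕ) :
    sumsOfLength g n ⊆ AddSubmonoid.closure (Set.range g) := by
  induction n with
  | zero => exact subset_rfl
  | succ n ih => exact (sumsOfLength_succ_subset n).trans ih

theorem add_mem_sumsOfLength {m n s u : ℕ} (hs : s ∈ sumsOfLength g m)
    (hu : u ∈ sumsOfLength g n) : s + u ∈ sumsOfLength g (m + n) := by
  induction m generalizing s with
  | zero =>
    rw [zero_add]
    induction n generalizing u with
    | zero => exact AddSubmonoid.add_mem _ hs hu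
    | succ n ih =>
      obtain ⟨i, u, hu, rfl⟩ := hu
      exact ⟨i, s + u, ih hu, by ring⟩
  | succ m ih =>
    obtain ⟨i, s, hs, rfl⟩ := hs
    rw [add_right_comm]
    exact ⟨i, s + u, ih hs, by ring⟩

theorem mem_sumsOfLength_one {s : ℕ} (hs : s ∈ AddSubmonoid.closure (Set.range g)) (h0 : s ≠ 0) :
    s ∈ sumsOfLength g 1 := by
  induction hs using AddSubmonoid.closure_induction with
  | mem s hs => obtain ⟨i, rfl⟩ := hs; exact ⟨i, 0, AddSubmonoid.zero_mem _, rfl⟩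
  | zero => exact absurd rfl h0
  | add s u _ hu' hs hu =>
    rcases eq_or_ne s 0 with rfl | h
    · rw [zero_add] at h0 ⊢
      exact hu h0
    · exact add_mem_sumsOfLength (n := 0) (hs h) hu'

theorem smul_mem_sumsOfLength (n : ℕ) (i : ι) : n * g i ∈ sumsOfLength g n := by
  induction n with
  | zero => rw [zero_mul]; exact AddSubmonoid.zero_mem _
  | succ n ih => exact ⟨i, _, ih, by ring⟩

end SumsOfLength

section SemigroupPowerSeries

variable {k : Type*} [Field k]

/-- The monomial `t ^ s` of a semigroup ring. -/
def semigroupMonomial (k : Type*) [Field k] {Γ : AddSubmonoid ℕ} (s : ℕ) (hs : s ∈ Γ) :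
    semigroupPowerSeries k Γ :=
  ⟨X ^ s, fun n hn => by
    rw [coeff_X_pow] at hn
    split_ifs at hn with h
    · exact h ▸ hs
    · exact absurd rfl hn⟩

theorem mem_maximalIdeal_semigroupPowerSeries_iff {Γ : AddSubmonoid ℕ}
    {f : semigroupPowerSeries k Γ} :
    f ∈ IsLocalRing.maximalIdeal (semigroupPowerSeries k Γ) ↔ coeff 0 (f : k⟦X⟧) = 0 := by
  rw [IsLocalRing.mem_maximalIdeal, mem_nonunits_iff, isUnit_semigroupPowerSeries_iff, not_not,
    coeff_zero_eq_constantCoeff_apply]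

theorem exists_sub_algebraMap_mem_maximalIdeal_semigroupPowerSeries {Γ : AddSubmonoid ℕ}
    (f : semigroupPowerSeries k Γ) :
    ∃ c : k, f - algebraMap k _ c ∈ IsLocalRing.maximalIdeal (semigroupPowerSeries k Γ) := by
  refine ⟨coeff 0 (f : k⟦X⟧), mem_maximalIdeal_semigroupPowerSeries_iff.2 ?_⟩
  change coeff 0 ((f : k⟦X⟧) - C (coeff 0 (f : k⟦X⟧))) = 0
  simp

variable {ι : Type*} {g : ι → ℕ}

local notation "Γ" => AddSubmonoid.closure (Set.range g)

variable (k g) in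
/-- The monomial `t ^ (g i)` of the semigroup ring of the semigroup generated by the `g i`. -/
def generatorMonomial (i : ι) : semigroupPowerSeries k Γ :=
  semigroupMonomial k (g i) (AddSubmonoid.subset_closure ⟨i, rfl⟩)

/-- Each exponent `s` of `f` is assigned one generator `g (σ s)` that can be split off. `F i`
collects the terms assigned to `i`, divided by `t ^ g i`; this works coefficientwise, even for
infinitely many terms. -/
theorem exists_eq_sum_generatorMonomial_mul [Fintype ι] {n : ℕ} {f : semigroupPowerSeries k Γ}
    (hf : ∀ s, coeff s (f : k⟦X⟧) ≠ 0 → s ∈ sumsOfLength g (n + 1)) :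
    ∃ F : ι → semigroupPowerSeries k Γ,
      (∀ i s, coeff s (F i : k⟦X⟧) ≠ 0 → s ∈ sumsOfLength g n) ∧
        f = ∑ i, generatorMonomial k g i * F i := by
  classical
  rcases isEmpty_or_nonempty ι with hι | hι
  · refine ⟨isEmptyElim, isEmptyElim, Subtype.ext (PowerSeries.ext fun s => ?_)⟩
    by_contra hne
    exact isEmptyElim (hf s fun h0 => hne (by simp [h0])).choose
  choose! σ u hu hσ using hf
  let F : ι → k⟦X⟧ := fun i => PowerSeries.mk fun v =>
    if σ (g i + v) = i then coeff (g i + v) (f : k⟦X⟧) else 0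
  have hF : ∀ i s, coeff s (F i) ≠ 0 → s ∈ sumsOfLength g n := by
    intro i s hs
    simp only [F, coeff_mk] at hs
    split_ifs at hs with h
    · have h1 := hσ _ hs
      have h2 := hu _ hs
      rw [h] at h1
      rwa [← Nat.add_left_cancel h1] at h2
    · exact absurd rfl hs
  refine ⟨fun i => ⟨F i, fun s hs => sumsOfLength_subset_closure n (hF i s hs)⟩, hF,
    Subtype.ext ?_⟩
  rw [AddSubmonoidClass.coe_finsetSum]
  ext s
  rw [map_sum]
  have hterm : ∀ i, coeff s ((generatorMonomial k g i * ⟨F i, fun s hs =>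
      sumsOfLength_subset_closure n (hF i s hs)⟩ : semigroupPowerSeries k Γ) : k⟦X⟧) =
      if i = σ s then coeff s (f : k⟦X⟧) else 0 := by
    intro i
    change coeff s (X ^ g i * F i) = _
    rw [coeff_X_pow_mul']
    split_ifs with h1 h2 h2
    · rw [coeff_mk, Nat.add_sub_cancel' h1, if_pos h2.symm]
    · rw [coeff_mk, Nat.add_sub_cancel' h1, if_neg (Ne.symm h2)]
    · by_contra h3
      have := hσ s (Ne.symm h3)
      rw [h2] at h1
      omega
    · rfl
  rw [Finset.sum_congr rfl fun i _ => hterm i, Finset.sum_ite_eq' Finset.univ (σ s),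
    if_pos (Finset.mem_univ _)]

theorem generatorMonomial_mem_maximalIdeal (hpos : ∀ i, g i ≠ 0) (i : ι) :
    generatorMonomial k g i ∈ IsLocalRing.maximalIdeal (semigroupPowerSeries k Γ) := by
  rw [mem_maximalIdeal_semigroupPowerSeries_iff]
  change coeff 0 (X ^ g i : k⟦X⟧) = 0
  rw [coeff_X_pow, if_neg (hpos i).symm]

theorem mem_sumsOfLength_one_of_mem_maximalIdeal {f : semigroupPowerSeries k Γ}
    (hf : f ∈ IsLocalRing.maximalIdeal (semigroupPowerSeries k Γ)) {s : ℕ}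
    (hs : coeff s (f : k⟦X⟧) ≠ 0) : s ∈ sumsOfLength g 1 := by
  refine mem_sumsOfLength_one (f.2 s hs) ?_
  rintro rfl
  exact hs (mem_maximalIdeal_semigroupPowerSeries_iff.1 hf)

theorem maximalIdeal_eq_span_generatorMonomial [Finite ι] (hpos : ∀ i, g i ≠ 0) :
    IsLocalRing.maximalIdeal (semigroupPowerSeries k Γ) =
      Ideal.span (Set.range (generatorMonomial k g)) := by
  have := Fintype.ofFinite ι
  refine le_antisymm (fun f hf => ?_) (Ideal.span_le.2 ?_)
  · obtain ⟨F, -, rfl⟩ := exists_eq_sum_generatorMonomial_mul (n := 0)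
      fun s hs => mem_sumsOfLength_one_of_mem_maximalIdeal hf hs
    exact Ideal.sum_mem _ fun i _ => Ideal.mul_mem_right _ _ (Ideal.subset_span ⟨i, rfl⟩)
  · rintro _ ⟨i, rfl⟩
    exact generatorMonomial_mem_maximalIdeal hpos i

/-- The power series in the `n`-th power of the maximal ideal of a semigroup ring are those whose
exponents are sums of at least `n` generators. -/
theorem mem_maximalIdeal_pow_iff [Finite ι] (hpos : ∀ i, g i ≠ 0) {n : ℕ}
    {f : semigroupPowerSeries k Γ} :
    f ∈ IsLocalRing.maximalIdeal (semigroupPowerSeries k Γ) ^ n ↔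
      ∀ s, coeff s (f : k⟦X⟧) ≠ 0 → s ∈ sumsOfLength g n := by
  have := Fintype.ofFinite ι
  induction n generalizing f with
  | zero =>
    rw [pow_zero, Ideal.one_eq_top]
    exact ⟨fun _ => f.2, fun _ => Submodule.mem_top⟩
  | succ n ih =>
    refine ⟨fun hf => ?_, fun hf => ?_⟩
    · rw [pow_succ'] at hf
      refine Submodule.mul_induction_on hf (fun a ha b hb s hs => ?_) fun a b ha hb s hs => ?_
      · rw [Subalgebra.coe_mul, coeff_mul] at hs
        obtain ⟨uv, huv, hne⟩ := Finset.exists_ne_zero_of_sum_ne_zero hs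
        rw [← Finset.HasAntidiagonal.mem_antidiagonal.1 huv, add_comm n 1]
        exact add_mem_sumsOfLength
          (mem_sumsOfLength_one_of_mem_maximalIdeal ha (left_ne_zero_of_mul hne))
          (ih.1 hb _ (right_ne_zero_of_mul hne))
      · rw [Subalgebra.coe_add, map_add] at hs
        by_cases h : coeff s (a : k⟦X⟧) = 0
        · exact hb s fun h' => hs (by rw [h, h', add_zero])
        · exact ha s h
    · obtain ⟨F, hF, rfl⟩ := exists_eq_sum_generatorMonomial_mul hf
      rw [pow_succ']
      exact Ideal.sum_mem _ fun i _ =>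
        Ideal.mul_mem_mul (generatorMonomial_mem_maximalIdeal hpos i) (ih.2 (hF i))

/-- If `g i₀` is the smallest generator, and adding it to an element of the semigroup raises the
maximal number of summands by exactly one, then the tangent cone is Cohen–Macaulay. -/
theorem isCohenMacaulayRing_tangentCone_semigroupPowerSeries [Finite ι] (i₀ : ι) (h0 : g i₀ ≠ 0)
    (hlt : ∀ i, i ≠ i₀ → g i₀ < g i)
    (hadd : ∀ n, ∀ s ∈ Γ, g i₀ + s ∈ sumsOfLength g (n + 1) → s ∈ sumsOfLength g n) :
    IsCohenMacaulayRing (TangentCone (semigroupPowerSeries k Γ)) := by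
  have hpos : ∀ i, g i ≠ 0 := by
    intro i
    rcases eq_or_ne i i₀ with rfl | hi
    · exact h0
    · exact (Nat.zero_lt_of_lt (hlt i hi)).ne'
  refine isCohenMacaulayRing_associatedGradedRing (k := k)
    (maximalIdeal_eq_span_generatorMonomial hpos)
    exists_sub_algebraMap_mem_maximalIdeal_semigroupPowerSeries i₀ (fun n a ha => ?_)
    -- The power `g i₀` works because `g i * g i₀` is also a sum of `g i > g i₀` copies of `g i₀`.
    fun i hi => ⟨g i₀, ?_⟩
  · rw [mem_maximalIdeal_pow_iff hpos] at ha ⊢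
    intro s hs
    refine hadd n s (a.2 s hs) (ha _ ?_)
    change coeff (g i₀ + s) (X ^ g i₀ * (a : k⟦X⟧)) ≠ 0
    rwa [add_comm, coeff_X_pow_mul]
  · rw [mem_maximalIdeal_pow_iff hpos]
    intro s hs
    change coeff s ((X ^ g i) ^ g i₀ : k⟦X⟧) ≠ 0 at hs
    rw [← pow_mul, coeff_X_pow] at hs
    have hs' : s = g i * g i₀ := by
      by_contra h
      exact hs (if_neg h)
    obtain ⟨d, hd⟩ := Nat.exists_eq_add_of_lt (hlt i hi)
    have hsum := add_mem_sumsOfLength (n := 0) (smul_mem_sumsOfLength (g := g) (g i₀ + 1) i₀)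
      (sumsOfLength_subset_closure _ (smul_mem_sumsOfLength (g := g) d i₀) :
        d * g i₀ ∈ sumsOfLength g 0)
    rw [hs', hd]
    convert hsum using 1
    ring

end SemigroupPowerSeries

/-! ### The Bresinsky semigroups -/

section Bresinsky

/-- The generators of the semigroup `Γ_h` of the Bresinsky curve. -/
def bresinskyGenerator (h : ℕ) : Fin 4 → ℕ :=
  ![2 * h * (2 * h - 1), (2 * h + 1) * (2 * h - 1), 2 * h * (2 * h + 1),
    2 * h * (2 * h + 1) + (2 * h - 1)]

theorem bresinskySemigroup_eq_closure_range (h : ℕ) :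
    bresinskySemigroup h = AddSubmonoid.closure (Set.range (bresinskyGenerator h)) := by
  rw [bresinskySemigroup, bresinskyGenerator]
  simp only [Matrix.range_cons, Matrix.range_empty, Set.union_empty, Set.singleton_union]

theorem mem_sumsOfLength_fin_four_iff {g : Fin 4 → ℕ} {n s : ℕ} :
    s ∈ sumsOfLength g n ↔ ∃ a b c d : ℕ,
      s = a * g 0 + b * g 1 + c * g 2 + d * g 3 ∧ n ≤ a + b + c + d := by
  constructor
  · have hstep : ∀ (i : Fin 4) (n u : ℕ), (∃ a b c d : ℕ,
        u = a * g 0 + b * g 1 + c * g 2 + d * g 3 ∧ n ≤ a + b + c + d) → ∃ a b c d : ℕ,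
        g i + u = a * g 0 + b * g 1 + c * g 2 + d * g 3 ∧ n + 1 ≤ a + b + c + d := by
      rintro i n _ ⟨a, b, c, d, rfl, h⟩
      fin_cases i
      · exact ⟨a + 1, b, c, d, by
          change g 0 + _ = _; ring, by omega⟩
      · exact ⟨a, b + 1, c, d, by
          change g 1 + _ = _; ring, by omega⟩
      · exact ⟨a, b, c + 1, d, by
          change g 2 + _ = _; ring, by omega⟩
      · exact ⟨a, b, c, d + 1, by
          change g 3 + _ = _; ring, by omega⟩
    intro hs
    induction n generalizing s with
    | zero =>
      refine AddSubmonoid.closure_induction_left (s := Set.range g)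
        (motive := fun s _ => ∃ a b c d : ℕ,
          s = a * g 0 + b * g 1 + c * g 2 + d * g 3 ∧ 0 ≤ a + b + c + d)
        ⟨0, 0, 0, 0, by simp, le_rfl⟩ ?_ hs
      rintro _ ⟨i, rfl⟩ u _ hu
      obtain ⟨a, b, c, d, h, -⟩ := hstep i 0 u hu
      exact ⟨a, b, c, d, h, Nat.zero_le _⟩
    | succ n ih =>
      obtain ⟨i, u, hu, rfl⟩ := hs
      exact hstep i n u (ih hu)
  · rintro ⟨a, b, c, d, rfl, h⟩
    have hle : ∀ m, n ≤ m → sumsOfLength g m ⊆ sumsOfLength g n := fun m hm =>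
      antitone_nat_of_succ_le (f := sumsOfLength g) sumsOfLength_succ_subset hm
    exact hle _ h (add_mem_sumsOfLength (add_mem_sumsOfLength (add_mem_sumsOfLength
      (smul_mem_sumsOfLength a 0) (smul_mem_sumsOfLength b 1)) (smul_mem_sumsOfLength c 2))
      (smul_mem_sumsOfLength d 3))

/-- With `q = 2h`, every element of `Γ_h` has a factorization in which the coefficients `b`, `c`,
`d` of `m₁`, `m₂`, `m₃` satisfy `b + d < q` and `c + d < q - 1`. -/
theorem exists_normal_factorization {q : ℕ} (hq : 2 ≤ q) (a b c d : ℕ) :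
    ∃ A B C D : ℕ, B + D < q ∧ C + D < q - 1 ∧
      ((A * (q * (q - 1)) + B * ((q + 1) * (q - 1)) + C * (q * (q + 1)) +
        D * (q * (q + 1) + (q - 1)) : ℤ)) =
      a * (q * (q - 1)) + b * ((q + 1) * (q - 1)) + c * (q * (q + 1)) +
        d * (q * (q + 1) + (q - 1)) := by
  -- From here on `p + 1`, `p + 2`, `p + 3` stand for `q - 1`, `q`, `q + 1`.
  obtain ⟨p, rfl⟩ : ∃ p, q = p + 2 := ⟨q - 2, by omega⟩
  have hu := Nat.mod_lt (b + d) (show p + 2 > 0 by omega)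
  have hv := Nat.mod_lt (c + d) (show p + 1 > 0 by omega)
  have hu' := Nat.div_add_mod (b + d) (p + 2)
  have hv' := Nat.div_add_mod (c + d) (p + 1)
  set u := (b + d) % (p + 2)
  set v := (c + d) % (p + 1)
  set i := (b + d) / (p + 2)
  set j := (c + d) / (p + 1)
  -- Writing `m₃ = m₁ + m₂ - m₀` and reducing the coefficients of `m₁`, `m₂` to `u`, `v` leaves `a -
  -- d + (q+1)(i+j)` as coefficient of `m₀`. Converting `min u v` pairs `m₁ + m₂` back to `m₀ + m₃`
  -- makes it nonnegative.
  have hd : d ≤ (p + 3) * (i + j) + min u v := by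
    rcases le_total u v with h | h
    · rw [min_eq_left h]
      nlinarith
    · rw [min_eq_right h]
      nlinarith
  obtain ⟨A, hA⟩ := Nat.exists_eq_add_of_le hd
  obtain ⟨B, hB⟩ := Nat.exists_eq_add_of_le (min_le_left u v)
  obtain ⟨C, hC⟩ := Nat.exists_eq_add_of_le (min_le_right u v)
  refine ⟨a + A, B, C, min u v, by omega, by omega, ?_⟩
  set D := min u v
  rw [hB] at hu'
  rw [hC] at hv'
  zify at hA hu' hv' ⊢
  linear_combination (((p : ℤ) + 2) * (p + 1)) * (-hA) + ((p + 3) * (p + 1)) * hu' +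
    ((p + 2) * (p + 3)) * hv'

/-- The normal factorizations are those of maximal length. -/
theorem length_le_of_normal_factorization {q : ℕ} (hq : 2 ≤ q) (heven : Even q)
    {a b c d A B C D : ℕ} (hB : B + D < q) (hC : C + D < q - 1)
    (heq : (A * (q * (q - 1)) + B * ((q + 1) * (q - 1)) + C * (q * (q + 1)) +
        D * (q * (q + 1) + (q - 1)) : ℤ) =
      a * (q * (q - 1)) + b * ((q + 1) * (q - 1)) + c * (q * (q + 1)) +
        d * (q * (q + 1) + (q - 1))) :
    a + b + c + d ≤ A + B + C + D := by
  -- Modulo `q`, `m₀` and `m₂` vanish while `m₁` and `m₃` are `-1`.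
  have hqd : (q : ℤ) ∣ (b + d) - (B + D) :=
    ⟨a * (q - 1) + b * q + c * (q + 1) + d * (q + 2) -
      (A * (q - 1) + B * q + C * (q + 1) + D * (q + 2)), by linear_combination heq⟩
  have hcop : IsCoprime ((q : ℤ) - 1) 2 := by
    obtain ⟨r, rfl⟩ := heven
    exact ⟨-1, r, by push_cast; ring⟩
  -- Modulo `q - 1`, `m₀` and `m₁` vanish while `m₂` and `m₃` are `2`, which is invertible because
  -- `q` is even.
  have hpd : (q : ℤ) - 1 ∣ (c + d) - (C + D) := by
    refine hcop.dvd_of_dvd_mul_left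
      ⟨A * q + B * (q + 1) + C * (q + 2) + D * (q + 3) -
        (a * q + b * (q + 1) + c * (q + 2) + d * (q + 3)), by linear_combination -heq⟩
  obtain ⟨i, hi⟩ := hqd
  obtain ⟨j, hj⟩ := hpd
  have hq' : (2 : ℤ) ≤ q := by exact_mod_cast hq
  have hB' : (B : ℤ) + D < q := by exact_mod_cast hB
  have hC' : (C : ℤ) + D < q - 1 := by
    have : C + D + 1 < q := by omega
    have : (C : ℤ) + D + 1 < q := by exact_mod_cast this
    linarith
  -- `B + D` and `C + D` are the least nonnegative residues, so `i` and `j` cannot be negative.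
  have hi0 : 0 ≤ i := by
    by_contra! h
    nlinarith [Int.natCast_nonneg b, Int.natCast_nonneg d]
  have hj0 : 0 ≤ j := by
    by_contra! h
    nlinarith [Int.natCast_nonneg c, Int.natCast_nonneg d]
  have hA : (A : ℤ) - D = a - d + (q + 1) * (i + j) := by
    have hne : (q : ℤ) * (q - 1) ≠ 0 := by
      have : (0 : ℤ) < q * (q - 1) := by nlinarith
      exact this.ne'
    refine mul_left_cancel₀ hne ?_
    linear_combination heq + ((q + 1) * (q - 1)) * hi + (q * (q + 1)) * hj
  -- The two lengths differ by `i + 2 * j`.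
  have : (a : ℤ) + b + c + d ≤ A + B + C + D := by nlinarith
  exact_mod_cast this

theorem cast_factorization_bresinskyGenerator {h : ℕ} (hh : 1 ≤ h) (a b c d : ℕ) :
    ((a * bresinskyGenerator h 0 + b * bresinskyGenerator h 1 + c * bresinskyGenerator h 2 +
      d * bresinskyGenerator h 3 : ℕ) : ℤ) =
      a * ((2 * h : ℕ) * ((2 * h : ℕ) - 1)) + b * (((2 * h : ℕ) + 1) * ((2 * h : ℕ) - 1)) +
        c * ((2 * h : ℕ) * ((2 * h : ℕ) + 1)) +
        d * ((2 * h : ℕ) * ((2 * h : ℕ) + 1) + ((2 * h : ℕ) - 1)) := by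
  have h1 : 1 ≤ 2 * h := by omega
  simp [bresinskyGenerator, Nat.cast_sub h1]

theorem mem_sumsOfLength_of_bresinskyGenerator_zero_add {h : ℕ} (hh : 1 ≤ h) {n s : ℕ}
    (hs : s ∈ AddSubmonoid.closure (Set.range (bresinskyGenerator h)))
    (hadd : bresinskyGenerator h 0 + s ∈ sumsOfLength (bresinskyGenerator h) (n + 1)) :
    s ∈ sumsOfLength (bresinskyGenerator h) n := by
  have hs0 : s ∈ sumsOfLength (bresinskyGenerator h) 0 := hs
  obtain ⟨a', b', c', d', hs', -⟩ := mem_sumsOfLength_fin_four_iff.1 hs0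
  obtain ⟨a, b, c, d, hsum, hlen⟩ := mem_sumsOfLength_fin_four_iff.1 hadd
  obtain ⟨A, B, C, D, hB, hC, heq⟩ :=
    exists_normal_factorization (q := 2 * h) (by omega) a' b' c' d'
  rw [← cast_factorization_bresinskyGenerator hh, ← cast_factorization_bresinskyGenerator hh,
    ← hs', Nat.cast_inj] at heq
  refine mem_sumsOfLength_fin_four_iff.2 ⟨A, B, C, D, heq.symm, ?_⟩
  -- Adding `m₀` to the normal factorization of `s` gives one of `m₀ + s`, again normal and hence of
  -- maximal length.
  have hle := length_le_of_normal_factorization (q := 2 * h) (a := a) (b := b) (c := c) (d := d)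
    (A := A + 1) (by omega) (even_two_mul h) hB hC (by
      rw [← cast_factorization_bresinskyGenerator hh, ← cast_factorization_bresinskyGenerator hh,
        ← hsum, ← heq]
      push_cast
      ring)
  omega

theorem bresinskyGenerator_zero_lt {h : ℕ} (hh : 1 ≤ h) {i : Fin 4} (hi : i ≠ 0) :
    bresinskyGenerator h 0 < bresinskyGenerator h i := by
  obtain ⟨p, hp⟩ : ∃ p, 2 * h = p + 2 := ⟨2 * h - 2, by omega⟩
  fin_cases i
  · exact absurd rfl hi
  all_goals
    simp only [bresinskyGenerator, hp]
    simp
    try nlinarith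

end Bresinsky

end

theorem mainTheorem2 (k : Type*) [Field k] (h : ℕ) (hh : 2 ≤ h) :
    IsCohenMacaulayRing (TangentCone (semigroupPowerSeries k (bresinskySemigroup h))) := by
  have h1 : 1 ≤ h := by omega
  rw [bresinskySemigroup_eq_closure_range]
  refine isCohenMacaulayRing_tangentCone_semigroupPowerSeries 0 ?_
    (fun i hi => bresinskyGenerator_zero_lt h1 hi)
    fun n s hs => mem_sumsOfLength_of_bresinskyGenerator_zero_add h1 hs
  exact (Nat.mul_pos (by omega) (by omega) : 0 < 2 * h * (2 * h - 1)).ne'
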